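/- For a real matrix $A$ let $\|A\|_F$, $\|A\|_*$ and $\|A\|_\infty=\max_{i,j}|A_{ij}|$ denote its Frobenius, nuclear and element-wise maximum norm. A matrix $Y\in\mathbb{R}^{d_1\times d_2}$ is called approximately rank-$r$ if $\|Y\|_*\le \|Y\|_\infty\sqrt{r d_1 d_2}$. There are absolute constants $C,K>0$ such that the following holds. Let $d_1,d_2\ge 1$ and $d,r\ge 0$ be integers and let $\alpha,\beta,\epsilon\in\mathbb{R}$. Let $\check X\in\mathbb{R}^{d_1\times d}$ and $M\in\mathbb{R}^{d\times d_2}$ be (deterministic) matrices such that $\check XM$ is approximately rank-$r$ and $\|\check XM\|_\infty\le\alpha$. Let $G\in\mathbb{R}^{d_1\times d_2}$ be a random matrix with independent zero-mean entries and $\|G\|_\infty\le\beta$ almost surely. Let $X\in\mathbb{R}^{d_1\times d}$ and $W\in\mathbb{R}^{d\times d_2}$ be matrices, which may be random and depend on $G$, such that almost surely $$\|XW-(\check XM+G)\|_F^2\le\epsilon\, d_1d_2 .$$ Put $$\Omega:=\{N\in\mathbb{R}^{d\times d_2}:\ \|\check XN\|_*\le\alpha\sqrt{r d_1d_2},\ \|\check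 XN\|_\infty\le\alpha\}.$$ Then $\operatorname{argmin}_{Z\in\Omega}\|XW-\check XZ\|_F$ is nonempty and, with probability at least $1-\frac{K}{d_1+d_2}$, every $\hat M\in\operatorname{argmin}_{Z\in\Omega}\|XW-\check XZ\|_F$ satisfies $$\frac{\|\check XM-\check X\hat M\|_F^2}{d_1d_2}\le C\left((\alpha^2+\alpha\beta)\sqrt{\frac{r(d_1+d_2)}{d_1d_2}}+\epsilon\right).$$ -/

import Mathlib

open MeasureTheory ProbabilityTheory

section Frobenius

open scoped Matrix.Norms.Frobenius

/-- The Frobenius norm `‖A‖_F` of a real matrix. -/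
noncomputable def frobNorm {m n : ℕ} (A : Matrix (Fin m) (Fin n) ℝ) : ℝ := ‖A‖

/-- The Frobenius norm is the square root of the sum of the squares of the entries. -/
theorem frobNorm_eq_sqrt {m n : ℕ} (A : Matrix (Fin m) (Fin n) ℝ) :
    frobNorm A = Real.sqrt (∑ i, ∑ j, A i j ^ 2) := by
  simp [frobNorm, Matrix.frobenius_norm_def, Real.sqrt_eq_rpow]

end Frobenius

section Elementwise

open scoped Matrix.Norms.Elementwise

/-- The element-wise `ℓ_∞` norm `‖A‖_∞ = max_{i,j} |A i j|` of a real matrix. -/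
noncomputable def maxNorm {m n : ℕ} (A : Matrix (Fin m) (Fin n) ℝ) : ℝ := ‖A‖

/-- The element-wise norm is at most `c ≥ 0` exactly if all entries are at most `c` in modulus. -/
theorem maxNorm_le_iff {m n : ℕ} (A : Matrix (Fin m) (Fin n) ℝ) {c : ℝ} (hc : 0 ≤ c) :
    maxNorm A ≤ c ↔ ∀ i j, |A i j| ≤ c := by
  simp [maxNorm, Matrix.norm_le_iff hc]

end Elementwise

/-- The nuclear norm `‖A‖_*` of a real `m × n` matrix: the sum of its singular values. Mathlib
lists the singular values of a linear map on an `n`-dimensional space in decreasing order, with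
multiplicity, and they vanish from index `min m n` on. -/
noncomputable def nuclearNorm {m n : ℕ} (A : Matrix (Fin m) (Fin n) ℝ) : ℝ :=
  ∑ i : Fin n, (Matrix.toEuclideanLin A).singularValues i

/-- A matrix `Y` is approximately rank-`r` if `‖Y‖_* ≤ ‖Y‖_∞ √(r d₁ d₂)`. -/
def IsApproxRank {d₁ d₂ : ℕ} (r : ℕ) (Y : Matrix (Fin d₁) (Fin d₂) ℝ) : Prop :=
  nuclearNorm Y ≤ maxNorm Y * Real.sqrt ((r : ℝ) * d₁ * d₂)

/-- The feasible set of all `N` with `‖A N‖_* ≤ α √(r d₁ d₂)` and `‖A N‖_∞ ≤ α`. -/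
def feasibleSet {d₁ d d₂ : ℕ} (A : Matrix (Fin d₁) (Fin d) ℝ) (α : ℝ) (r : ℕ) :
    Set (Matrix (Fin d) (Fin d₂) ℝ) :=
  {N | nuclearNorm (A * N) ≤ α * Real.sqrt ((r : ℝ) * d₁ * d₂) ∧ maxNorm (A * N) ≤ α}

/-- The set of minimizers of `Z ↦ ‖T - A Z‖_F` over the feasible set. -/
def argminSet {d₁ d d₂ : ℕ} (T : Matrix (Fin d₁) (Fin d₂) ℝ) (A : Matrix (Fin d₁) (Fin d) ℝ)
    (α : ℝ) (r : ℕ) : Set (Matrix (Fin d) (Fin d₂) ℝ) :=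
  {Z | Z ∈ feasibleSet A α r ∧ IsMinOn (fun Z' => frobNorm (T - A * Z')) (feasibleSet A α r) Z}

/-! Write $Y=\check XM$ and $\hat Y=\check X\hat M$. Since $M$ is feasible, optimality of $\hat M$
bounds $\|Y-\hat Y\|_F^2$ by $4\langle\hat Y-Y,G\rangle$ plus four times the squared residual, which
is almost surely at most $\epsilon d_1d_2$ (`frobNorm_sq_sub_le_of_frobNorm_le`). Duality of nuclear
and operator norm bounds the pairing by $2\alpha\sqrt{rd_1d_2}\,\|G\|_{op}$. This holds uniformly
over the feasible set, so the dependence of $X$, $W$ and $\hat M$ on $G$ is harmless.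

Only $\|G\|_{op}$ needs probability: Hoeffding's inequality and a union bound over nets of at most
$5^{d_1}$ and $5^{d_2}$ points give $10\beta\sqrt{d_1+d_2}$ (`exists_measurableSet_opNorm_le`).
Minimizers exist because the products $\check XN$ with $N$ feasible form a compact set. -/

/-! ### Nuclear norm and its duality with the operator norm -/

section Nuclear

/-- The singular values of a matrix are the lengths of the images of some orthonormal basis
whose image is an orthogonal family. -/
theorem exists_orthonormalBasis_nuclearNorm {m n : ℕ} (A : Matrix (Fin m) (Fin n) ℝ) :
    ∃ b : OrthonormalBasis (Fin n) ℝ (EuclideanSpace ℝ (Fin n)),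
      nuclearNorm A = ∑ i, ‖Matrix.toEuclideanLin A (b i)‖ ∧
      ∀ i j, i ≠ j →
        inner ℝ (Matrix.toEuclideanLin A (b i)) (Matrix.toEuclideanLin A (b j)) = 0 := by
  set T := Matrix.toEuclideanLin A with hT
  have hn : Module.finrank ℝ (EuclideanSpace ℝ (Fin n)) = n := by simp
  have hsym := T.isSymmetric_adjoint_comp_self
  -- The basis is an eigenbasis of `T* T`, whose eigenvalues are the squared singular values.
  have key : ∀ i j, inner ℝ (T (hsym.eigenvectorBasis hn i)) (T (hsym.eigenvectorBasis hn j))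
      = hsym.eigenvalues hn j *
        inner ℝ (hsym.eigenvectorBasis hn i) (hsym.eigenvectorBasis hn j) := by
    intro i j
    rw [← LinearMap.adjoint_inner_right, ← LinearMap.comp_apply, hsym.apply_eigenvectorBasis hn j,
      inner_smul_right]
    rfl
  refine ⟨hsym.eigenvectorBasis hn, ?_, ?_⟩
  · unfold nuclearNorm
    refine Finset.sum_congr rfl fun i _ => ?_
    rw [T.singularValues_fin hn i, ← Real.sqrt_sq (norm_nonneg (T _)),
      ← real_inner_self_eq_norm_sq, key, real_inner_self_eq_norm_sq,
      OrthonormalBasis.norm_eq_one]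
    simp
  · intro i j hij
    rw [key, (hsym.eigenvectorBasis hn).orthonormal.2 hij, mul_zero]

/-- The entrywise inner product of two matrices computed along any orthonormal basis. -/
theorem sum_mul_eq_sum_inner {m n : ℕ} (A B : Matrix (Fin m) (Fin n) ℝ)
    (b : OrthonormalBasis (Fin n) ℝ (EuclideanSpace ℝ (Fin n))) :
    ∑ i, ∑ j, A i j * B i j =
      ∑ k, inner ℝ (Matrix.toEuclideanLin A (b k)) (Matrix.toEuclideanLin B (b k)) := by
  -- The sum is the trace of `A* B`, hence independent of the basis.
  have h : ∀ c : OrthonormalBasis (Fin n) ℝ (EuclideanSpace ℝ (Fin n)),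
      ∑ k, inner ℝ (Matrix.toEuclideanLin A (c k)) (Matrix.toEuclideanLin B (c k)) =
      LinearMap.trace ℝ _
        ((Matrix.toEuclideanLin A).adjoint ∘ₗ (Matrix.toEuclideanLin B)) := by
    intro c
    rw [LinearMap.trace_eq_sum_inner _ c]
    simp [LinearMap.adjoint_inner_right]
  rw [h b, ← h (EuclideanSpace.basisFun (Fin n) ℝ), Finset.sum_comm]
  refine Finset.sum_congr rfl fun j _ => ?_
  simp [PiLp.inner_apply, Matrix.toLpLin_apply, mul_comm]

/-- Duality between the nuclear norm and the operator norm. -/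
theorem abs_sum_mul_le_nuclearNorm_mul {m n : ℕ} (A B : Matrix (Fin m) (Fin n) ℝ) {t : ℝ}
    (hB : ∀ v, ‖Matrix.toEuclideanLin B v‖ ≤ t * ‖v‖) :
    |∑ i, ∑ j, A i j * B i j| ≤ nuclearNorm A * t := by
  obtain ⟨b, hb, -⟩ := exists_orthonormalBasis_nuclearNorm A
  rw [sum_mul_eq_sum_inner A B b, hb, Finset.sum_mul]
  refine (Finset.abs_sum_le_sum_abs _ _).trans (Finset.sum_le_sum fun k _ => ?_)
  refine (abs_real_inner_le_norm _ _).trans ?_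
  have := hB (b k)
  rw [b.norm_eq_one, mul_one] at this
  gcongr

/-- The nuclear norm is attained by pairing with a contraction. -/
theorem exists_contraction_sum_mul_eq_nuclearNorm {m n : ℕ} (A : Matrix (Fin m) (Fin n) ℝ) :
    ∃ B : Matrix (Fin m) (Fin n) ℝ, (∀ v, ‖Matrix.toEuclideanLin B v‖ ≤ ‖v‖) ∧
      ∑ i, ∑ j, A i j * B i j = nuclearNorm A := by
  obtain ⟨b, hb, horth⟩ := exists_orthonormalBasis_nuclearNorm A
  set T := Matrix.toEuclideanLin A
  -- `U` is the partial isometry of the polar decomposition; since `0⁻¹ = 0`, it kills every `b i`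
  -- in the kernel of `T`.
  set w : Fin n → EuclideanSpace ℝ (Fin m) := fun i => ‖T (b i)‖⁻¹ • T (b i) with hw
  set U : EuclideanSpace ℝ (Fin n) →ₗ[ℝ] EuclideanSpace ℝ (Fin m) :=
    b.toBasis.constr ℝ w with hU
  have hUb : ∀ i, U (b i) = w i := fun i => by
    rw [hU, ← b.coe_toBasis, Module.Basis.constr_basis]
  have hBU : Matrix.toEuclideanLin (Matrix.toEuclideanLin.symm U) = U :=
    LinearEquiv.apply_symm_apply _ _
  refine ⟨Matrix.toEuclideanLin.symm U, fun v => ?_, ?_⟩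
  · rw [hBU]
    have hv : U v = ∑ i, inner ℝ (b i) v • w i := by
      conv_lhs => rw [← b.sum_repr' v]
      simp [hUb]
    have hwo : ∀ i j, i ≠ j → inner ℝ (w i) (w j) = 0 := fun i j hij => by
      simp [hw, inner_smul_left, inner_smul_right, horth i j hij]
    have hw1 : ∀ i, ‖w i‖ ≤ 1 := fun i => by
      rw [hw, norm_smul, norm_inv, norm_norm]
      exact inv_mul_le_one
    rw [← sq_le_sq₀ (norm_nonneg _) (norm_nonneg _), ← b.sum_sq_norm_inner_right v,
      ← real_inner_self_eq_norm_sq, hv, sum_inner]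
    refine Finset.sum_le_sum fun i _ => ?_
    rw [inner_sum, Finset.sum_eq_single i]
    · rw [inner_smul_left, inner_smul_right, real_inner_self_eq_norm_sq, Real.norm_eq_abs, sq_abs]
      have h1 : ‖w i‖ ^ 2 ≤ 1 := pow_le_one₀ (norm_nonneg _) (hw1 i)
      simp only [conj_trivial]
      nlinarith [sq_nonneg (inner ℝ (b i) v)]
    · intro j _ hj
      rw [inner_smul_left, inner_smul_right, hwo i j hj.symm]
      simp
    · simp
  · rw [sum_mul_eq_sum_inner A _ b, hBU, hb]
    refine Finset.sum_congr rfl fun i _ => ?_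
    rw [hUb, hw, inner_smul_right, real_inner_self_eq_norm_sq]
    by_cases h : ‖T (b i)‖ = 0
    · change ‖T (b i)‖⁻¹ * ‖T (b i)‖ ^ 2 = ‖T (b i)‖
      simp [h]
    · change ‖T (b i)‖⁻¹ * ‖T (b i)‖ ^ 2 = ‖T (b i)‖
      field_simp

/-- By duality the sublevel set is an intersection of closed sets given by linear inequalities, one
for each contraction `B`. -/
theorem isClosed_nuclearNorm_le {m n : ℕ} (c : ℝ) :
    IsClosed {A : Matrix (Fin m) (Fin n) ℝ | nuclearNorm A ≤ c} := by
  have : {A : Matrix (Fin m) (Fin n) ℝ | nuclearNorm A ≤ c} =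
      ⋂ B ∈ {B : Matrix (Fin m) (Fin n) ℝ | ∀ v, ‖Matrix.toEuclideanLin B v‖ ≤ ‖v‖},
        {A | ∑ i, ∑ j, A i j * B i j ≤ c} := by
    ext A
    simp only [Set.mem_ofPred_eq, Set.mem_iInter]
    constructor
    · intro hA B hB
      have := abs_sum_mul_le_nuclearNorm_mul A B (t := 1) (by simpa using hB)
      rw [mul_one] at this
      exact (le_abs_self _).trans (this.trans hA)
    · intro h
      obtain ⟨B, hB, hAB⟩ := exists_contraction_sum_mul_eq_nuclearNorm A
      exact hAB ▸ h B hB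
  rw [this]
  refine isClosed_biInter fun B _ => isClosed_le ?_ continuous_const
  fun_prop

end Nuclear

/-! ### Existence of minimizers -/

section Argmin

theorem maxNorm_nonneg {m n : ℕ} (A : Matrix (Fin m) (Fin n) ℝ) : 0 ≤ maxNorm A :=
  letI := Matrix.normedAddCommGroup (m := Fin m) (n := Fin n) (α := ℝ)
  norm_nonneg A

theorem isCompact_maxNorm_le {m n : ℕ} (c : ℝ) :
    IsCompact {A : Matrix (Fin m) (Fin n) ℝ | maxNorm A ≤ c} := by
  by_cases hc : 0 ≤ c
  · have : {A : Matrix (Fin m) (Fin n) ℝ | maxNorm A ≤ c} =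
        Set.pi Set.univ fun _ => Set.pi Set.univ fun _ => Set.Icc (-c) c := by
      ext A
      simp only [Set.mem_ofPred_eq, maxNorm_le_iff A hc, abs_le]
      exact ⟨fun h i _ j _ => h i j, fun h i j => h i trivial j trivial⟩
    rw [this]
    exact isCompact_univ_pi fun _ => isCompact_univ_pi fun _ => isCompact_Icc
  · convert isCompact_empty
    ext A
    simpa using (not_le.mp hc).trans_le (maxNorm_nonneg A)

/-- The feasible set is unbounded if `A` has a kernel, so compactness is used for the products `A *
N` instead: they lie in a finite-dimensional, hence closed, subspace. -/
theorem argminSet_nonempty {d₁ d d₂ : ℕ} (T : Matrix (Fin d₁) (Fin d₂) ℝ)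
    (A : Matrix (Fin d₁) (Fin d) ℝ) (α : ℝ) (r : ℕ)
    (h : (feasibleSet A α r : Set (Matrix (Fin d) (Fin d₂) ℝ)).Nonempty) :
    (argminSet T A α r).Nonempty := by
  let L : Matrix (Fin d) (Fin d₂) ℝ →ₗ[ℝ] Matrix (Fin d₁) (Fin d₂) ℝ := mulLeftLinearMap _ ℝ A
  let c := α * Real.sqrt ((r : ℝ) * d₁ * d₂)
  have hcomp : IsCompact ({Y : Matrix (Fin d₁) (Fin d₂) ℝ | maxNorm Y ≤ α} ∩
      ({Y | nuclearNorm Y ≤ c} ∩ (LinearMap.range L : Set _))) :=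
    (isCompact_maxNorm_le α).inter_right
      ((isClosed_nuclearNorm_le c).inter (Submodule.closed_of_finiteDimensional _))
  obtain ⟨N, hN⟩ := h
  have hcont : Continuous fun Y : Matrix (Fin d₁) (Fin d₂) ℝ => frobNorm (T - Y) := by
    simp_rw [frobNorm_eq_sqrt, Matrix.sub_apply]
    fun_prop
  obtain ⟨_, ⟨hmax, hnuc, Z, rfl⟩, hZ⟩ :=
    hcomp.exists_isMinOn ⟨A * N, hN.2, hN.1, N, rfl⟩ hcont.continuousOn
  exact ⟨Z, ⟨hnuc, hmax⟩, fun Z' hZ' => hZ ⟨hZ'.2, hZ'.1, Z', rfl⟩⟩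

end Argmin

/-! ### Nets and operator norms -/

section Net

/-- The ball of radius `2` has a `1`-net with at most `5 ^ dim` points. -/
theorem exists_finset_net (E : Type*) [NormedAddCommGroup E] [NormedSpace ℝ E]
    [FiniteDimensional ℝ E] :
    ∃ s : Finset E, s.card ≤ 5 ^ Module.finrank ℝ E ∧ (∀ c ∈ s, ‖c‖ ≤ 2) ∧
      ∀ x : E, ‖x‖ ≤ 2 → ∃ c ∈ s, ‖x - c‖ < 1 := by
  classical
  let P : ℕ → Prop := fun k => ∃ s : Finset E, s.card = k ∧ (∀ c ∈ s, ‖c‖ ≤ 2) ∧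
    ∀ c ∈ s, ∀ d ∈ s, c ≠ d → 1 ≤ ‖c - d‖
  have hbd : ∀ k, P k → k ≤ 5 ^ Module.finrank ℝ E := by
    rintro _ ⟨s, rfl, h2, hsep⟩
    exact Besicovitch.card_le_of_separated s h2 hsep
  have h0 : P 0 := ⟨∅, by simp⟩
  -- A 1-separated set of greatest size is a net: a point far from all of it could be added.
  obtain ⟨s, hcard, h2, hsep⟩ := Nat.findGreatest_spec (Nat.zero_le (5 ^ Module.finrank ℝ E)) h0
  refine ⟨s, hbd _ ⟨s, rfl, h2, hsep⟩, h2, fun x hx => ?_⟩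
  by_contra! hfar
  have hxs : x ∉ s := fun hmem => by
    have := hfar x hmem
    norm_num at this
  have hP : P (s.card + 1) := by
    refine ⟨insert x s, Finset.card_insert_of_notMem hxs, ?_, ?_⟩
    · simpa using ⟨hx, h2⟩
    · intro c hc d hd hcd
      rw [Finset.mem_insert] at hc hd
      rcases hc with rfl | hc <;> rcases hd with rfl | hd
      · exact absurd rfl hcd
      · exact hfar d hd
      · rw [norm_sub_rev]
        exact hfar c hc
      · exact hsep c hc d hd hcd
  have := Nat.le_findGreatest (hbd _ hP) hP
  omega

/-- A bound for the values of a linear map on a net bounds its operator norm. -/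
theorem norm_apply_le_of_net {E F : Type*} [NormedAddCommGroup E] [NormedSpace ℝ E]
    [FiniteDimensional ℝ E] [NormedAddCommGroup F] [NormedSpace ℝ F]
    (f : E →ₗ[ℝ] F) {s : Finset E} (hs : ∀ x : E, ‖x‖ ≤ 2 → ∃ c ∈ s, ‖x - c‖ < 1)
    {t : ℝ} (ht : 0 ≤ t) (h : ∀ c ∈ s, ‖f c‖ ≤ t) (x : E) : ‖f x‖ ≤ t * ‖x‖ := by
  let g : E →L[ℝ] F := LinearMap.toContinuousLinearMap f
  -- For a unit vector `x`, the point `2x` is within 1 of the net, so `2‖g x‖ ≤ t + ‖g‖`; the term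
  -- `‖g‖` is then absorbed.
  have hg : ‖g‖ ≤ (t + ‖g‖) / 2 := by
    refine g.opNorm_le_of_unit_norm (by positivity) fun x hx => ?_
    obtain ⟨c, hc, hxc⟩ := hs ((2 : ℝ) • x) (by rw [norm_smul, hx]; norm_num)
    have h1 : g ((2 : ℝ) • x) = g c + g ((2 : ℝ) • x - c) := by simp
    have h2 : ‖g ((2 : ℝ) • x)‖ ≤ t + ‖g‖ * 1 := by
      rw [h1]
      refine (norm_add_le _ _).trans (add_le_add (h c hc) ((g.le_opNorm _).trans ?_))
      gcongr
    rw [map_smul, norm_smul] at h2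
    norm_num at h2
    linarith
  have : ‖g‖ ≤ t := by linarith
  exact (g.le_opNorm x).trans (by gcongr)

/-- A bound for the bilinear form of a linear map on a product of nets bounds its operator norm. -/
theorem norm_apply_le_of_net_inner {E F : Type*} [NormedAddCommGroup E] [NormedSpace ℝ E]
    [FiniteDimensional ℝ E] [NormedAddCommGroup F] [InnerProductSpace ℝ F] [FiniteDimensional ℝ F]
    (f : E →ₗ[ℝ] F) {s : Finset E} (hs : ∀ x : E, ‖x‖ ≤ 2 → ∃ c ∈ s, ‖x - c‖ < 1)
    {s' : Finset F} (hs' : ∀ x : F, ‖x‖ ≤ 2 → ∃ c ∈ s', ‖x - c‖ < 1)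
    {t : ℝ} (ht : 0 ≤ t) (h : ∀ c ∈ s, ∀ u ∈ s', inner ℝ u (f c) ≤ t) (x : E) :
    ‖f x‖ ≤ t * ‖x‖ := by
  refine norm_apply_le_of_net f hs ht (fun c hc => ?_) x
  by_cases h0 : f c = 0
  · simpa [h0] using ht
  have hpos : 0 < ‖f c‖ := norm_pos_iff.mpr h0
  -- With `u` within 1 of twice the direction of `f c`, `2‖f c‖ - ⟨u, f c⟩ ≤ ‖f c‖`.
  obtain ⟨u, hu, hlt⟩ := hs' ((2 * ‖f c‖⁻¹) • f c) (by
    rw [norm_smul, norm_mul, norm_inv, norm_norm, mul_assoc, inv_mul_cancel₀ hpos.ne']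
    norm_num)
  have h1 : inner ℝ ((2 * ‖f c‖⁻¹) • f c) (f c) = 2 * ‖f c‖ := by
    rw [inner_smul_left, real_inner_self_eq_norm_sq]
    simp only [conj_trivial]
    field_simp
  have h2 := real_inner_le_norm ((2 * ‖f c‖⁻¹) • f c - u) (f c)
  rw [inner_sub_left, h1] at h2
  have h3 := h c hc u hu
  nlinarith

end Net

/-! ### Concentration of the operator norm of the noise -/

section Concentration

variable {S : Type*} [MeasurableSpace S] {μ : Measure S}

theorem ProbabilityTheory.HasSubgaussianMGF.mono_const {X : S → ℝ} {c c' : NNReal}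
    (h : HasSubgaussianMGF X c μ) (hc : c ≤ c') : HasSubgaussianMGF X c' μ where
  integrable_exp_mul := h.integrable_exp_mul
  mgf_le t := (h.mgf_le t).trans (by gcongr)

theorem inner_toEuclideanLin {m n : ℕ} (A : Matrix (Fin m) (Fin n) ℝ)
    (u : EuclideanSpace ℝ (Fin m)) (v : EuclideanSpace ℝ (Fin n)) :
    inner ℝ u (Matrix.toEuclideanLin A v) = ∑ p : Fin m × Fin n, (u p.1 * v p.2) * A p.1 p.2 := by
  rw [Fintype.sum_prod_type]
  simp only [PiLp.inner_apply, Matrix.toLpLin_apply, Matrix.mulVec, dotProduct]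
  refine Finset.sum_congr rfl fun i _ => ?_
  simp only [RCLike.inner_apply, conj_trivial, Finset.sum_mul]
  exact Finset.sum_congr rfl fun j _ => by ring

/-- Hoeffding's inequality for a bilinear form in a random matrix. -/
theorem measure_inner_toEuclideanLin_ge_le [IsProbabilityMeasure μ] {m n : ℕ} {β : ℝ}
    (G : S → Matrix (Fin m) (Fin n) ℝ)
    (hmeas : ∀ i j, Measurable (fun ω => G ω i j))
    (hind : iIndepFun (fun (p : Fin m × Fin n) (ω : S) => G ω p.1 p.2) μ)
    (hmean : ∀ i j, ∫ ω, G ω i j ∂μ = 0) (hβ : ∀ᵐ ω ∂μ, ∀ i j, |G ω i j| ≤ β)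
    (u : EuclideanSpace ℝ (Fin m)) (v : EuclideanSpace ℝ (Fin n)) (hu : ‖u‖ ≤ 2) (hv : ‖v‖ ≤ 2)
    {s : ℝ} (hs : 0 ≤ s) :
    μ.real {ω | s ≤ inner ℝ u (Matrix.toEuclideanLin (G ω) v)} ≤
      Real.exp (-s ^ 2 / (32 * β ^ 2)) := by
  have hsub : ∀ p ∈ (Finset.univ : Finset (Fin m × Fin n)),
      HasSubgaussianMGF (fun ω => (u p.1 * v p.2) * G ω p.1 p.2)
        (Real.toNNReal ((u p.1 * v p.2) ^ 2) * (‖β - -β‖₊ / 2) ^ 2) μ := by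
    intro p _
    rw [Real.toNNReal_of_nonneg (sq_nonneg _)]
    refine HasSubgaussianMGF.const_mul ?_ _
    refine hasSubgaussianMGF_of_mem_Icc_of_integral_eq_zero (hmeas _ _).aemeasurable ?_
      (hmean _ _)
    filter_upwards [hβ] with ω hω
    exact abs_le.mp (hω _ _)
  have hind' : iIndepFun (fun (p : Fin m × Fin n) ω => (u p.1 * v p.2) * G ω p.1 p.2) μ :=
    hind.comp (fun p x => (u p.1 * v p.2) * x) fun p => by fun_prop
  have hsum := HasSubgaussianMGF.sum_of_iIndepFun hind' hsub
  -- The variance proxies add up to `β² ‖u‖² ‖v‖²`, and both norms are at most 2.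
  have hc : ((∑ p : Fin m × Fin n,
      Real.toNNReal ((u p.1 * v p.2) ^ 2) * (‖β - -β‖₊ / 2) ^ 2 : NNReal) : ℝ)
      ≤ 16 * β ^ 2 := by
    rw [NNReal.coe_sum]
    simp only [NNReal.coe_mul, NNReal.coe_pow, NNReal.coe_div, coe_nnnorm,
      Real.coe_toNNReal _ (sq_nonneg _)]
    rw [← Finset.sum_mul, Fintype.sum_prod_type]
    have h1 : ∑ i, ∑ j, (u i * v j) ^ 2 = ‖u‖ ^ 2 * ‖v‖ ^ 2 := by
      rw [EuclideanSpace.real_norm_sq_eq, EuclideanSpace.real_norm_sq_eq, Finset.sum_mul_sum]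
      simp only [mul_pow]
    have h2 : (‖β - -β‖ / (2 : NNReal)) ^ 2 = β ^ 2 := by
      rw [div_pow, Real.norm_eq_abs, sq_abs, NNReal.coe_ofNat]
      ring
    rw [h1, h2]
    have h3 : ‖u‖ ^ 2 ≤ 2 ^ 2 := by gcongr
    have h4 : ‖v‖ ^ 2 ≤ 2 ^ 2 := by gcongr
    have h5 : ‖u‖ ^ 2 * ‖v‖ ^ 2 ≤ 16 := by nlinarith [sq_nonneg ‖u‖, sq_nonneg ‖v‖]
    gcongr
  have hsum' := hsum.mono_const (c' := Real.toNNReal (16 * β ^ 2)) (by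
    rw [← NNReal.coe_le_coe, Real.coe_toNNReal _ (by positivity)]
    exact hc)
  have hfin := hsum'.measure_ge_le hs
  simp_rw [inner_toEuclideanLin]
  refine hfin.trans (le_of_eq ?_)
  congr 2
  rw [Real.coe_toNNReal _ (by positivity)]
  ring

/-- The rate `25/8` exceeds `2 > log 5`, so the exponential beats the size of the nets. -/
theorem five_pow_mul_exp_le {n : ℕ} (hn : 0 < n) :
    (5 : ℝ) ^ n * Real.exp (-(25 / 8) * n) ≤ 1 / n := by
  have h5 : (5 : ℝ) ≤ Real.exp 2 := by
    have h1 := Real.exp_one_gt_d9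
    have h2 : Real.exp 2 = Real.exp 1 * Real.exp 1 := by
      rw [← Real.exp_add]
      norm_num
    rw [h2]
    nlinarith
  have hn' : (0 : ℝ) < n := by exact_mod_cast hn
  calc (5 : ℝ) ^ n * Real.exp (-(25 / 8) * n)
      ≤ Real.exp 2 ^ n * Real.exp (-(25 / 8) * n) := by gcongr
    _ = Real.exp (-(9 / 8 * n)) := by
        rw [← Real.exp_nat_mul, ← Real.exp_add]
        ring_nf
    _ = 1 / Real.exp (9 / 8 * n) := by rw [Real.exp_neg, one_div]
    _ ≤ 1 / n := by
        have := Real.add_one_le_exp (9 / 8 * (n : ℝ))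
        gcongr
        linarith

/-- The operator norm of a random matrix with independent centred entries bounded by `β` is at
most `10 β √(m + n)` with probability at least `1 - 1 / (m + n)`. -/
theorem exists_measurableSet_opNorm_le [IsProbabilityMeasure μ] {m n : ℕ} (hmn : 0 < m + n) {β : ℝ}
    (hβ0 : 0 ≤ β) (G : S → Matrix (Fin m) (Fin n) ℝ)
    (hmeas : ∀ i j, Measurable (fun ω => G ω i j))
    (hind : iIndepFun (fun (p : Fin m × Fin n) (ω : S) => G ω p.1 p.2) μ)
    (hmean : ∀ i j, ∫ ω, G ω i j ∂μ = 0) (hβ : ∀ᵐ ω ∂μ, ∀ i j, |G ω i j| ≤ β) :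
    ∃ E : Set S, MeasurableSet E ∧ 1 - 1 / ((m : ℝ) + n) ≤ μ.real E ∧
      ∀ ω ∈ E, ∀ v, ‖Matrix.toEuclideanLin (G ω) v‖ ≤ 10 * β * Real.sqrt ((m : ℝ) + n) * ‖v‖ := by
  have hmn' : (0 : ℝ) < (m : ℝ) + n := by exact_mod_cast hmn
  -- The Hoeffding exponent divides by `β²`, so `β = 0`, where `G` vanishes almost surely, is
  -- separate.
  rcases hβ0.eq_or_lt with rfl | hβpos
  · obtain ⟨E, hE, hEm, hE0⟩ := hβ.exists_measurable_mem
    refine ⟨E, hEm, ?_, fun ω hω v => ?_⟩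
    · rw [measureReal_def, mem_ae_iff_prob_eq_one hEm |>.mp hE]
      simpa using hmn'.le
    · have : G ω = 0 := by
        ext i j
        simpa using hE0 ω hω i j
      simp [this]
  obtain ⟨s, hscard, hs2, hs⟩ := exists_finset_net (EuclideanSpace ℝ (Fin n))
  obtain ⟨s', hscard', hs2', hs'⟩ := exists_finset_net (EuclideanSpace ℝ (Fin m))
  rw [finrank_euclideanSpace_fin] at hscard hscard'
  set t := 10 * β * Real.sqrt ((m : ℝ) + n) with ht
  have ht0 : 0 ≤ t := by positivity
  let bad : EuclideanSpace ℝ (Fin n) × EuclideanSpace ℝ (Fin m) → Set S :=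
    fun q => {ω | t ≤ inner ℝ q.2 (Matrix.toEuclideanLin (G ω) q.1)}
  have hbadm : ∀ q, MeasurableSet (bad q) := fun q => by
    refine measurableSet_le measurable_const ?_
    simp_rw [inner_toEuclideanLin]
    fun_prop
  have hBm : MeasurableSet (⋃ q ∈ s ×ˢ s', bad q) :=
    Finset.measurableSet_biUnion _ fun q _ => hbadm q
  refine ⟨(⋃ q ∈ s ×ˢ s', bad q)ᶜ, hBm.compl, ?_, ?_⟩
  · rw [probReal_compl_eq_one_sub hBm]
    refine sub_le_sub_left ?_ _
    -- `25/8` is `10² / 32`.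
    have hexp : -t ^ 2 / (32 * β ^ 2) = -(25 / 8) * ((m + n : ℕ) : ℝ) := by
      rw [ht, mul_pow, Real.sq_sqrt hmn'.le]
      push_cast
      field_simp
      ring
    calc μ.real (⋃ q ∈ s ×ˢ s', bad q) ≤ ∑ q ∈ s ×ˢ s', μ.real (bad q) :=
          measureReal_biUnion_finset_le _ _
      _ ≤ ∑ q ∈ s ×ˢ s', Real.exp (-t ^ 2 / (32 * β ^ 2)) := by
          refine Finset.sum_le_sum fun q hq => ?_
          rw [Finset.mem_product] at hq
          exact measure_inner_toEuclideanLin_ge_le G hmeas hind hmean hβ q.2 q.1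
            (hs2' _ hq.2) (hs2 _ hq.1) ht0
      _ = (s.card * s'.card : ℕ) * Real.exp (-t ^ 2 / (32 * β ^ 2)) := by
          rw [Finset.sum_const, Finset.card_product, nsmul_eq_mul]
      _ ≤ (5 ^ n * 5 ^ m : ℕ) * Real.exp (-t ^ 2 / (32 * β ^ 2)) := by gcongr
      _ = (5 : ℝ) ^ (m + n) * Real.exp (-(25 / 8) * ((m + n : ℕ) : ℝ)) := by
          rw [hexp]
          push_cast
          ring
      _ ≤ 1 / ((m + n : ℕ) : ℝ) := five_pow_mul_exp_le hmn
      _ = 1 / ((m : ℝ) + n) := by push_cast; rfl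
  · intro ω hω v
    refine norm_apply_le_of_net_inner _ hs hs' ht0 (fun c hc u hu => ?_) v
    by_contra! hlt
    exact hω (Set.mem_biUnion (x := (c, u)) (Finset.mem_product.mpr ⟨hc, hu⟩) hlt.le)

end Concentration

/-! ### Deterministic error bound and conclusion -/

section Recovery

theorem frobNorm_sq {m n : ℕ} (A : Matrix (Fin m) (Fin n) ℝ) :
    frobNorm A ^ 2 = ∑ i, ∑ j, A i j ^ 2 := by
  rw [frobNorm_eq_sqrt, Real.sq_sqrt]
  positivity

/-- The basic inequality for least squares with noise `G` and residual `T - (Y + G)`. -/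
theorem frobNorm_sq_sub_le_of_frobNorm_le {m n : ℕ} (T Y Z G : Matrix (Fin m) (Fin n) ℝ)
    (h : frobNorm (T - Z) ≤ frobNorm (T - Y)) :
    frobNorm (Y - Z) ^ 2 ≤ 4 * (∑ i, ∑ j, Z i j * G i j - ∑ i, ∑ j, Y i j * G i j) +
      4 * frobNorm (T - (Y + G)) ^ 2 := by
  have h0 : 0 ≤ frobNorm (T - Z) := by
    rw [frobNorm_eq_sqrt]
    positivity
  have h1 : frobNorm (T - Z) ^ 2 ≤ frobNorm (T - Y) ^ 2 := by gcongr
  have h2 : ∑ i, ∑ j, ((Y - Z) i j ^ 2 - 4 * (Z i j * G i j - Y i j * G i j) -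
      4 * (T - (Y + G)) i j ^ 2) ≤ ∑ i, ∑ j, 2 * ((T - Z) i j ^ 2 - (T - Y) i j ^ 2) := by
    refine Finset.sum_le_sum fun i _ => Finset.sum_le_sum fun j _ => ?_
    simp only [Matrix.sub_apply, Matrix.add_apply]
    -- The right side minus the left side is exactly this square.
    nlinarith [sq_nonneg ((Y i j - Z i j) + 2 * (T i j - (Y i j + G i j)))]
  simp only [Finset.sum_sub_distrib, ← Finset.mul_sum, ← frobNorm_sq] at h2
  linarith

theorem mul_sqrt_mul_sqrt_div {r p q : ℝ} (hp : 0 < p) (hr : 0 ≤ r) (hq : 0 ≤ q) :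
    Real.sqrt (r * p) * Real.sqrt q / p = Real.sqrt (r * q / p) := by
  rw [← Real.sqrt_mul (by positivity), show r * p * q = (r * q / p) * p ^ 2 by field_simp,
    Real.sqrt_mul (by positivity), Real.sqrt_sq hp.le, mul_div_cancel_right₀ _ hp.ne']

/-- The error bound for a minimizer in terms of an operator norm bound for the noise. -/
theorem frobNorm_sq_sub_le_of_mem_argminSet {d₁ d d₂ r : ℕ} {α t : ℝ} (ht : 0 ≤ t)
    (A : Matrix (Fin d₁) (Fin d) ℝ) (M : Matrix (Fin d) (Fin d₂) ℝ)
    (T G : Matrix (Fin d₁) (Fin d₂) ℝ) (hM : M ∈ feasibleSet A α r)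
    (hG : ∀ v, ‖Matrix.toEuclideanLin G v‖ ≤ t * ‖v‖)
    {N : Matrix (Fin d) (Fin d₂) ℝ} (hN : N ∈ argminSet T A α r) :
    frobNorm (A * M - A * N) ^ 2 ≤ 8 * (α * Real.sqrt ((r : ℝ) * d₁ * d₂) * t) +
      4 * frobNorm (T - (A * M + G)) ^ 2 := by
  have h1 := frobNorm_sq_sub_le_of_frobNorm_le T (A * M) (A * N) G (hN.2 hM)
  have h2 : ∀ Z ∈ feasibleSet A α r, |∑ i, ∑ j, (A * Z) i j * G i j| ≤
      α * Real.sqrt ((r : ℝ) * d₁ * d₂) * t := fun Z hZ =>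
    (abs_sum_mul_le_nuclearNorm_mul (A * Z) G hG).trans (by gcongr; exact hZ.1)
  have h3 := abs_le.mp (h2 M hM)
  have h4 := abs_le.mp (h2 N hN.1)
  linarith [h3.1, h4.2]

end Recovery

theorem mainTheorem3 :
    ∃ C K : ℝ, 0 < C ∧ 0 < K ∧
      ∀ (d₁ d d₂ r : ℕ), 0 < d₁ → 0 < d₂ →
      ∀ (α β ε : ℝ)
        (Xc : Matrix (Fin d₁) (Fin d) ℝ) (M : Matrix (Fin d) (Fin d₂) ℝ),
      IsApproxRank r (Xc * M) →
      maxNorm (Xc * M) ≤ α →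
      ∀ (S : Type*) [MeasurableSpace S] (μ : Measure S) [IsProbabilityMeasure μ]
        (G : S → Matrix (Fin d₁) (Fin d₂) ℝ),
      (∀ i j, Measurable (fun ω => G ω i j)) →
      iIndepFun (fun (p : Fin d₁ × Fin d₂) (ω : S) => G ω p.1 p.2) μ →
      (∀ i j, ∫ ω, G ω i j ∂μ = 0) →
      (∀ᵐ ω ∂μ, maxNorm (G ω) ≤ β) →
      ∀ (X : S → Matrix (Fin d₁) (Fin d) ℝ) (W : S → Matrix (Fin d) (Fin d₂) ℝ),
      (∀ᵐ ω ∂μ, frobNorm (X ω * W ω - (Xc * M + G ω)) ^ 2 ≤ ε * (d₁ * d₂)) →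
      (∀ ω, (argminSet (X ω * W ω) Xc α r).Nonempty) ∧
      ∃ E : Set S, MeasurableSet E ∧ 1 - K / ((d₁ : ℝ) + d₂) ≤ μ.real E ∧
        ∀ ω ∈ E, ∀ Mhat ∈ argminSet (X ω * W ω) Xc α r,
          frobNorm (Xc * M - Xc * Mhat) ^ 2 / ((d₁ : ℝ) * d₂) ≤
            C * ((α ^ 2 + α * β) *
              Real.sqrt ((r : ℝ) * ((d₁ : ℝ) + d₂) / ((d₁ : ℝ) * d₂)) + ε) := by
  -- 80 is the factor 8 of the deterministic bound times the 10 of the operator norm bound; it also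
  -- covers the `4ε`.
  refine ⟨80, 1, by norm_num, one_pos, ?_⟩
  intro d₁ d d₂ r hd₁ hd₂ α β ε Xc M hrank hmax S _ μ _ G hmeas hind hmean hβ X W hXW
  have hα : 0 ≤ α := (maxNorm_nonneg _).trans hmax
  have hM : M ∈ feasibleSet Xc α r := ⟨hrank.trans (by gcongr), hmax⟩
  refine ⟨fun ω => argminSet_nonempty _ _ _ _ ⟨M, hM⟩, ?_⟩
  have hβ0 : 0 ≤ β := by
    obtain ⟨ω, hω⟩ := hβ.exists
    exact (maxNorm_nonneg _).trans hω
  have hβ' : ∀ᵐ ω ∂μ, ∀ i j, |G ω i j| ≤ β := by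
    filter_upwards [hβ] with ω hω
    exact (maxNorm_le_iff _ hβ0).mp hω
  obtain ⟨E, hEm, hEμ, hE⟩ :=
    exists_measurableSet_opNorm_le (by omega) hβ0 G hmeas hind hmean hβ'
  obtain ⟨F, hFae, hFm, hF⟩ := hXW.exists_measurable_mem
  -- `F` has full measure, so intersecting with it costs no probability.
  refine ⟨E ∩ F, hEm.inter hFm, ?_, ?_⟩
  · rwa [Set.inter_comm, measureReal_def, Measure.measure_inter_eq_of_ae hFae, ← measureReal_def]
  · rintro ω ⟨hωE, hωF⟩ N hN
    have h1 := frobNorm_sq_sub_le_of_mem_argminSet (by positivity) Xc M _ (G ω) hM (hE ω hωE) hN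
    have h2 := hF ω hωF
    have hd : (0 : ℝ) < (d₁ : ℝ) * d₂ := by positivity
    rw [← mul_sqrt_mul_sqrt_div hd (Nat.cast_nonneg r) (by positivity), ← mul_assoc (r : ℝ)]
    rw [div_le_iff₀ hd]
    have hε : 0 ≤ ε * (d₁ * d₂) := (sq_nonneg _).trans h2
    have h3 : 80 * ((α ^ 2 + α * β) * (Real.sqrt ((r : ℝ) * d₁ * d₂) *
        Real.sqrt ((d₁ : ℝ) + d₂) / ((d₁ : ℝ) * d₂)) + ε) * ((d₁ : ℝ) * d₂) =
        80 * ((α ^ 2 + α * β) * (Real.sqrt ((r : ℝ) * d₁ * d₂) * Real.sqrt ((d₁ : ℝ) + d₂))) +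
          80 * (ε * (d₁ * d₂)) := by
      field_simp
    -- The estimate yields only the `αβ` term; the `α²` term is slack.
    have h4 : 0 ≤ α ^ 2 * (Real.sqrt ((r : ℝ) * d₁ * d₂) * Real.sqrt ((d₁ : ℝ) + d₂)) := by
      positivity
    rw [h3]
    linarith
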